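/- Let $\mathcal T$ be a metric space, let $a\colon\mathcal T\to\mathbb R^n$ and $b\colon\mathcal T\to\mathbb R$ be continuous, and let $h\colon\mathbb R^n\to\mathbb R$. Put $M(t):=\{x\in\mathbb R^n\mid\langle a(t),x\rangle\le b(t)\}$ for $t\in\mathcal T$, and let $\bar x$ be a local minimizer of the problem $$\text{minimize } h(x)\ \text{ subject to }\ \langle a(t),x\rangle\le b(t)\ \text{ for all } t\in\mathcal T,$$ that is, $\bar x\in\bigcap_{t\in\mathcal T}M(t)$ and $h(\bar x)\le h(x)$ for all $x\in\bigcap_{t\in\mathcal T}M(t)$ near $\bar x$. Assume that $h$ is Fréchet differentiable at $\bar x$. Let $\mathcal T_f:=\{t\in\mathcal T\mid\langle a(t),\bar x\rangle=b(t)\}$ be the set of active indices, and assume that $a(t)\ne0$ for all $t\in\mathcal T_f$ and that $$\bar x\in\mathrm{int}\bigcap_{t\in\mathcal T\setminus\mathcal T_f}\{x\in\mathbb R^n\mid\langle a(t),x\rangle<b(t)\}.$$ Then the following hold. 1. The conical hull intersection property (CHIP) holds at $\bar x$ over $\mathcal T$ and over $\mathcal T_f$: for $A=\mathcal T$ and for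 $A=\mathcal T_f$, $$T\Big(\bar x;\bigcap_{t\in A}M(t)\Big)=\bigcap_{t\in A}T\big(\bar x;M(t)\big),$$ where $T(\bar x;\Theta)$ denotes the contingent cone, i.e. the set of all $w\in\mathbb R^n$ for which there are $\tau_k\downarrow0$ and $w_k\to w$ with $\bar x+\tau_kw_k\in\Theta$ for all $k$ (and an intersection over an empty index set is $\mathbb R^n$). 2. For every finite measure $\nu$ on the Borel $\sigma$-algebra of $\mathcal T_f$ that is strictly positive (every nonempty relatively open subset of $\mathcal T_f$ has positive measure), $$0\in\nabla h(\bar x)+\mathrm{cl}\Big(\int_{\mathcal T_f}\mathrm{cone}\{a(t)\}\,d\nu(t)\Big).$$ Here $\mathrm{cone}\{a(t)\}=\{\lambda a(t)\mid\lambda\ge0\}$, and the integral is the Aumann integral: the set of all $\int_{\mathcal T_f}g\,d\nu$ with $g\in L^1(\nu;\mathbb R^n)$ and $g(t)\in\mathrm{cone}\{a(t)\}$ for $\nu$-almost every $t$. -/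

import Mathlib

open MeasureTheory Filter Topology
open scoped Pointwise Gradient

namespace SIP

/-- The conic hull `{c • x | c ≥ 0, x ∈ S}` of a set. -/
def conicHull {E : Type*} [AddCommGroup E] [Module ℝ E] (S : Set E) : Set E :=
  {y | ∃ c : ℝ, 0 ≤ c ∧ ∃ x ∈ S, y = c • x}

/-- The Aumann integral of a set-valued mapping: the set of integrals of all integrable
almost-everywhere selections. -/
def aumannIntegral {Ω E : Type*} [MeasurableSpace Ω] [NormedAddCommGroup E] [NormedSpace ℝ E]
    (M : Ω → Set E) (μ : Measure Ω) : Set E :=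
  {y | ∃ f : Ω → E, Integrable f μ ∧ (∀ᵐ ω ∂μ, f ω ∈ M ω) ∧ ∫ ω, f ω ∂μ = y}

/-- At a point of the set, `posTangentConeAt` is the contingent cone: the outer limit of
`(S - x) / τ` as `τ ↓ 0`. -/
theorem mem_posTangentConeAt_iff_seq {E : Type*} [NormedAddCommGroup E] [NormedSpace ℝ E]
    {S : Set E} {x w : E} (hx : x ∈ S) :
    w ∈ posTangentConeAt S x ↔ ∃ (τ : ℕ → ℝ) (v : ℕ → E),
      (∀ k, 0 < τ k) ∧ Tendsto τ atTop (𝓝 0) ∧ Tendsto v atTop (𝓝 w) ∧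
        ∀ k, x + τ k • v k ∈ S := by
  constructor
  · intro h
    have h0 := tendsto_one_div_add_atTop_nhds_zero_nat (𝕜 := ℝ)
    by_cases hw : w = 0
    · exact ⟨fun k => 1 / ((k : ℝ) + 1), fun _ => 0, fun k => by positivity, h0, by simp [hw],
        by simpa using hx⟩
    · obtain ⟨ι, l, hl, c, d, hd, hdS, hcd⟩ := exists_fun_of_mem_tangentConeAt h
      have hwn : 0 < ‖w‖ := norm_pos_iff.2 hw
      have key : ∀ k : ℕ, ∃ (τ : ℝ) (v : E), 0 < τ ∧ τ < 1 / ((k : ℝ) + 1) ∧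
          ‖v - w‖ < 1 / ((k : ℝ) + 1) ∧ x + τ • v ∈ S := by
        intro k
        have ep : (0 : ℝ) < 1 / ((k : ℝ) + 1) := by positivity
        have e1 : ∀ᶠ i in l, ‖d i‖ < 1 / ((k : ℝ) + 1) * (‖w‖ / 2) := by
          have := hd.norm
          rw [norm_zero] at this
          exact this.eventually_lt_const (by positivity)
        have e2 : ∀ᶠ i in l, ‖c i • d i - w‖ < 1 / ((k : ℝ) + 1) :=
          (tendsto_iff_norm_sub_tendsto_zero.1 hcd).eventually_lt_const ep
        have e3 : ∀ᶠ i in l, ‖w‖ / 2 < ‖c i • d i‖ :=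
          hcd.norm.eventually_const_lt (by linarith)
        obtain ⟨i, ⟨⟨⟨hi1, hi2⟩, hi3⟩, hi4⟩⟩ := (((e1.and e2).and e3).and hdS).exists
        rw [NNReal.smul_def] at hi2 hi3
        have hc : (0 : ℝ) < c i := by
          rcases (c i).coe_nonneg.lt_or_eq with hc | hc
          · exact hc
          · rw [← hc, zero_smul, norm_zero] at hi3
            linarith
        refine ⟨(c i : ℝ)⁻¹, (c i : ℝ) • d i, inv_pos.2 hc, ?_, hi2, ?_⟩
        · rw [norm_smul, Real.norm_of_nonneg hc.le] at hi3
          rw [inv_lt_iff_one_lt_mul₀ hc]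
          have := mul_lt_mul_of_pos_left hi1 hc
          have h5 : 1 * (‖w‖ / 2) < (c i * (1 / ((k : ℝ) + 1))) * (‖w‖ / 2) := by linarith
          have h6 := lt_of_mul_lt_mul_right h5 (by positivity)
          linarith
        · rwa [smul_smul, inv_mul_cancel₀ hc.ne', one_smul]
      choose τ v h1 h2 h3 h4 using key
      exact ⟨τ, v, h1, squeeze_zero (fun k => (h1 k).le) (fun k => (h2 k).le) h0,
        tendsto_iff_norm_sub_tendsto_zero.2
          (squeeze_zero (fun k => norm_nonneg _) (fun k => (h3 k).le) h0), h4⟩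
  · rintro ⟨τ, v, h1, h2, h3, h4⟩
    refine mem_tangentConeAt_of_seq (atTop : Filter ℕ)
      (fun k => Real.toNNReal (τ k)⁻¹) (fun k => τ k • v k) ?_ ?_ ?_
    · simpa using h2.smul h3
    · exact Eventually.of_forall h4
    · refine h3.congr fun k => ?_
      rw [NNReal.smul_def, Real.coe_toNNReal _ (inv_pos.2 (h1 k)).le, smul_smul,
        inv_mul_cancel₀ (h1 k).ne', one_smul]

/-- The conical hull intersection property of the subfamily `(M t)`, `t ∈ A`, at `x`:
the contingent cone of the intersection is the intersection of the contingent cones. -/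
def CHIP {T E : Type*} [NormedAddCommGroup E] [NormedSpace ℝ E]
    (M : T → Set E) (A : Set T) (x : E) : Prop :=
  posTangentConeAt (⋂ t ∈ A, M t) x = ⋂ t ∈ A, posTangentConeAt (M t) x

variable {n : ℕ} {T : Type*}

/-- The closed half-space (or whole space, or empty set) `{x | ⟨a t, x⟩ ≤ b t}`. -/
def halfSpace (a : T → EuclideanSpace ℝ (Fin n)) (b : T → ℝ) (t : T) :
    Set (EuclideanSpace ℝ (Fin n)) :=
  {x | inner ℝ (a t) x ≤ b t}

/-- The feasible set of the linear inequality system. -/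
def feasibleSet (a : T → EuclideanSpace ℝ (Fin n)) (b : T → ℝ) :
    Set (EuclideanSpace ℝ (Fin n)) :=
  ⋂ t, halfSpace a b t

/-- The set of active indices at `x`. -/
def activeSet (a : T → EuclideanSpace ℝ (Fin n)) (b : T → ℝ)
    (x : EuclideanSpace ℝ (Fin n)) : Set T :=
  {t | inner ℝ (a t) x - b t = 0}

end SIP

namespace SIP

variable {n : ℕ} {T : Type*}

/-! Near the point only active constraints can fail, and these are linear with equality at the
point. Hence the tangent cone of the feasible set is the polar of the active `a t`
(`mem_posTangentConeAt_feasibleSet` gives the hard inclusion), and CHIP follows. At a local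
minimizer `∇ h` is nonnegative on this polar, so by Hahn–Banach its negative lies in any closed
convex cone whose polar is no larger. The closed Aumann integral is such a cone: strict positivity
of the measure and continuity of `a` let it detect every single `a t`. -/

theorem inner_nonpos_of_mem_posTangentConeAt_halfSpace
    {a : T → EuclideanSpace ℝ (Fin n)} {b : T → ℝ} {x w : EuclideanSpace ℝ (Fin n)} {t : T}
    (ht : t ∈ activeSet a b x) (hw : w ∈ posTangentConeAt (halfSpace a b t) x) :
    inner ℝ (a t) w ≤ 0 := by
  have hx : inner ℝ (a t) x - b t = 0 := ht
  obtain ⟨τ, v, hτ, -, hv, hmem⟩ :=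
    (mem_posTangentConeAt_iff_seq (show x ∈ halfSpace a b t from sub_nonpos.1 hx.le)).1 hw
  refine le_of_tendsto (tendsto_const_nhds.inner hv) (Eventually.of_forall fun k => ?_)
  have hk : inner ℝ (a t) (x + τ k • v k) ≤ b t := hmem k
  rw [inner_add_right, real_inner_smul_right] at hk
  exact nonpos_of_mul_nonpos_right (by linarith) (hτ k)

/-- Directions satisfying the linearized active constraints are tangent to the feasible set when
the inactive constraints do not bind near the point. -/
theorem mem_posTangentConeAt_feasibleSet
    {a : T → EuclideanSpace ℝ (Fin n)} {b : T → ℝ} {x w : EuclideanSpace ℝ (Fin n)}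
    (hint : x ∈ interior (⋂ t ∈ (activeSet a b x)ᶜ,
      {y : EuclideanSpace ℝ (Fin n) | inner ℝ (a t) y < b t}))
    (hw : ∀ t ∈ activeSet a b x, inner ℝ (a t) w ≤ 0) :
    w ∈ posTangentConeAt (feasibleSet a b) x := by
  have hlim : Tendsto (fun s : ℝ => x + s • w) (𝓝[>] 0) (𝓝 x) := by
    have : Continuous fun s : ℝ => x + s • w := by fun_prop
    simpa using (this.tendsto 0).mono_left nhdsWithin_le_nhds
  refine mem_posTangentConeAt_of_frequently_mem (Eventually.frequently ?_)
  filter_upwards [hlim (mem_interior_iff_mem_nhds.1 hint), self_mem_nhdsWithin] with s hs hs0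
  refine Set.mem_iInter.2 fun t => ?_
  by_cases ht : t ∈ activeSet a b x
  · have hx : inner ℝ (a t) x - b t = 0 := ht
    show inner ℝ (a t) (x + s • w) ≤ b t
    rw [inner_add_right, real_inner_smul_right]
    have := mul_nonpos_of_nonneg_of_nonpos (le_of_lt hs0) (hw t ht)
    linarith
  · exact le_of_lt (show inner ℝ (a t) (x + s • w) < b t from Set.mem_iInter₂.1 hs t ht)

/-- One inclusion is monotonicity of tangent cones. For the other, tangency to the active
half-spaces alone already forces tangency to the whole feasible set, which lies inside the
intersection over `A`. -/
theorem chip_of_activeSet_subset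
    {a : T → EuclideanSpace ℝ (Fin n)} {b : T → ℝ} {x : EuclideanSpace ℝ (Fin n)}
    (hint : x ∈ interior (⋂ t ∈ (activeSet a b x)ᶜ,
      {y : EuclideanSpace ℝ (Fin n) | inner ℝ (a t) y < b t}))
    {A : Set T} (hA : activeSet a b x ⊆ A) : CHIP (halfSpace a b) A x := by
  refine Set.Subset.antisymm
    (Set.subset_iInter₂ fun t ht => tangentConeAt_mono (Set.biInter_subset_of_mem ht)) fun w hw => ?_
  refine tangentConeAt_mono (fun y hy => Set.mem_iInter₂.2 fun t _ => Set.mem_iInter.1 hy t)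
    (mem_posTangentConeAt_feasibleSet hint fun t ht => ?_)
  exact inner_nonpos_of_mem_posTangentConeAt_halfSpace ht (Set.mem_iInter₂.1 hw t (hA ht))

section AumannIntegral

variable {Ω E : Type*} [MeasurableSpace Ω] [NormedAddCommGroup E] [NormedSpace ℝ E]
  {a : Ω → E} {μ : Measure Ω}

theorem zero_mem_aumannIntegral_conicHull :
    (0 : E) ∈ aumannIntegral (fun ω => conicHull {a ω}) μ :=
  ⟨fun _ => 0, integrable_zero _ _ _,
    Eventually.of_forall fun ω => ⟨0, le_rfl, a ω, rfl, (zero_smul ℝ _).symm⟩, by simp⟩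

theorem smul_mem_aumannIntegral_conicHull {c : ℝ} (hc : 0 ≤ c) {y : E}
    (hy : y ∈ aumannIntegral (fun ω => conicHull {a ω}) μ) :
    c • y ∈ aumannIntegral (fun ω => conicHull {a ω}) μ := by
  obtain ⟨f, hf, hfa, rfl⟩ := hy
  refine ⟨fun ω => c • f ω, hf.smul c, ?_, integral_smul c f⟩
  filter_upwards [hfa] with ω hω
  obtain ⟨r, hr, x, hx, hfx⟩ := hω
  exact ⟨c * r, mul_nonneg hc hr, x, hx, by rw [hfx, smul_smul]⟩

theorem add_mem_aumannIntegral_conicHull {y z : E}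
    (hy : y ∈ aumannIntegral (fun ω => conicHull {a ω}) μ)
    (hz : z ∈ aumannIntegral (fun ω => conicHull {a ω}) μ) :
    y + z ∈ aumannIntegral (fun ω => conicHull {a ω}) μ := by
  obtain ⟨f, hf, hfa, rfl⟩ := hy
  obtain ⟨g, hg, hga, rfl⟩ := hz
  refine ⟨fun ω => f ω + g ω, hf.add hg, ?_, integral_add hf hg⟩
  filter_upwards [hfa, hga] with ω hω hω'
  obtain ⟨r, hr, x, rfl, hfx⟩ := hω
  obtain ⟨s, hs, y, rfl, hgy⟩ := hω'
  exact ⟨r + s, add_nonneg hr hs, _, rfl, by rw [hfx, hgy, add_smul]⟩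

/-- The values are rays, hence convex cones, so selections combine pointwise and the measure may
have atoms. -/
theorem convex_aumannIntegral_conicHull :
    Convex ℝ (aumannIntegral (fun ω => conicHull {a ω}) μ) := fun _ hy _ hz _ _ hr hs _ =>
  add_mem_aumannIntegral_conicHull (smul_mem_aumannIntegral_conicHull hr hy)
    (smul_mem_aumannIntegral_conicHull hs hz)

/-- A functional that is nonpositive on the Aumann integral of the cones `cone {a ω}` is
nonpositive on every `a ω`, if the measure is strictly positive. -/
theorem apply_nonpos_of_forall_aumannIntegral [TopologicalSpace Ω] [OpensMeasurableSpace Ω]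
    [SecondCountableTopology E] [CompleteSpace E] [IsFiniteMeasure μ]
    [μ.IsOpenPosMeasure] (ha : Continuous a) {φ : E →L[ℝ] ℝ}
    (hφ : ∀ y ∈ aumannIntegral (fun ω => conicHull {a ω}) μ, φ y ≤ 0) (ω₀ : Ω) :
    φ (a ω₀) ≤ 0 := by
  by_contra! hpos
  -- The norm bound makes `a` integrable on `U`, since the measure is finite.
  set U : Set Ω := {ω | 0 < φ (a ω)} ∩ {ω | ‖a ω‖ < ‖a ω₀‖ + 1} with hU
  have hUo : IsOpen U := (isOpen_lt continuous_const (φ.continuous.comp ha)).inter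
    (isOpen_lt ha.norm continuous_const)
  have hUpos : 0 < μ U := hUo.measure_pos μ ⟨ω₀, hpos, lt_add_one ‖a ω₀‖⟩
  borelize E
  have hint : IntegrableOn a U μ :=
    Integrable.of_bound ha.measurable.aestronglyMeasurable (‖a ω₀‖ + 1)
      ((ae_restrict_mem hUo.measurableSet).mono fun ω hω => hω.2.le)
  -- The selection is `a` cut off outside `U`: coefficient 1 on `U`, 0 elsewhere.
  have hle := hφ (∫ ω in U, a ω ∂μ) ⟨U.indicator a,
    (integrable_indicator_iff hUo.measurableSet).2 hint, Eventually.of_forall fun ω => by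
      by_cases hω : ω ∈ U
      · exact ⟨1, zero_le_one, a ω, rfl, by simp [hω]⟩
      · exact ⟨0, le_rfl, a ω, rfl, by simp [hω]⟩,
    integral_indicator hUo.measurableSet⟩
  rw [← φ.integral_comp_comm hint] at hle
  refine hle.not_gt ((setIntegral_pos_iff_support_of_nonneg_ae
    ((ae_restrict_mem hUo.measurableSet).mono fun ω hω => hω.1.le) (φ.integrable_comp hint)).2 ?_)
  exact hUpos.trans_le (measure_mono fun ω hω => ⟨ne_of_gt hω.1, hω⟩)

/-- A point at which every functional nonpositive on all the `a ω` is nonpositive lies in the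
closed Aumann integral of the cones `cone {a ω}`. -/
theorem mem_closure_aumannIntegral_conicHull [TopologicalSpace Ω] [OpensMeasurableSpace Ω]
    [SecondCountableTopology E] [CompleteSpace E] [IsFiniteMeasure μ]
    [μ.IsOpenPosMeasure] (ha : Continuous a) {z : E}
    (hz : ∀ φ : E →L[ℝ] ℝ, (∀ ω, φ (a ω) ≤ 0) → φ z ≤ 0) :
    z ∈ closure (aumannIntegral (fun ω => conicHull {a ω}) μ) := by
  by_contra hmem
  obtain ⟨φ, u, hu, huz⟩ := geometric_hahn_banach_closed_point
    convex_aumannIntegral_conicHull.closure isClosed_closure hmem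
  have hu0 : 0 < u := by simpa using hu 0 (subset_closure zero_mem_aumannIntegral_conicHull)
  refine (hu0.trans huz).not_ge (hz φ
    (apply_nonpos_of_forall_aumannIntegral (μ := μ) ha fun y hy => ?_))
  by_contra! hy0
  -- A positive value of `φ` could be rescaled within the cone to equal `u`, contradicting the
  -- strict bound.
  have := hu _ (subset_closure
    (smul_mem_aumannIntegral_conicHull (div_nonneg hu0.le hy0.le) hy))
  rw [map_smul, smul_eq_mul, div_mul_cancel₀ _ hy0.ne'] at this
  exact this.false

end AumannIntegral

end SIP

theorem corollary7p4 {n : ℕ} {T : Type*} [MetricSpace T] [MeasurableSpace T] [BorelSpace T]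
    (h : EuclideanSpace ℝ (Fin n) → ℝ)
    (a : T → EuclideanSpace ℝ (Fin n)) (b : T → ℝ)
    (x₀ : EuclideanSpace ℝ (Fin n))
    (ha : Continuous a) (hb : Continuous b)
    (hh : DifferentiableAt ℝ h x₀)
    (hx₀ : x₀ ∈ SIP.feasibleSet a b)
    (hmin : IsLocalMinOn h (SIP.feasibleSet a b) x₀)
    (hne : ∀ t ∈ SIP.activeSet a b x₀, a t ≠ 0)
    (hint : x₀ ∈ interior (⋂ t ∈ (SIP.activeSet a b x₀)ᶜ,
      {x : EuclideanSpace ℝ (Fin n) | inner ℝ (a t) x < b t})) :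
    SIP.CHIP (SIP.halfSpace a b) Set.univ x₀ ∧
    SIP.CHIP (SIP.halfSpace a b) (SIP.activeSet a b x₀) x₀ ∧
    ∀ ν : Measure (SIP.activeSet a b x₀), IsFiniteMeasure ν → ν.IsOpenPosMeasure →
      (0 : EuclideanSpace ℝ (Fin n)) ∈
        {∇ h x₀} + closure (SIP.aumannIntegral
          (fun t : SIP.activeSet a b x₀ => SIP.conicHull {a t}) ν) := by
  refine ⟨SIP.chip_of_activeSet_subset hint (Set.subset_univ _),
    SIP.chip_of_activeSet_subset hint subset_rfl, fun ν _ _ => ?_⟩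
  refine Set.mem_add.2 ⟨_, rfl, -∇ h x₀,
    SIP.mem_closure_aumannIntegral_conicHull (ha.comp continuous_subtype_val) fun φ hφ => ?_,
    add_neg_cancel _⟩
  -- The Riesz representative of `φ` is a feasible direction, to which the first-order condition
  -- applies.
  set w := (InnerProductSpace.toDual ℝ (EuclideanSpace ℝ (Fin n))).symm φ with hw
  have hφw : ∀ y, φ y = inner ℝ w y := fun y => by
    rw [hw, InnerProductSpace.toDual_symm_apply]
  have hwT : w ∈ posTangentConeAt (SIP.feasibleSet a b) x₀ :=
    SIP.mem_posTangentConeAt_feasibleSet hint fun t ht => by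
      rw [real_inner_comm, ← hφw]
      exact hφ ⟨t, ht⟩
  have hderiv := hmin.hasFDerivWithinAt_nonneg
    hh.hasGradientAt.hasFDerivAt.hasFDerivWithinAt hwT
  rw [InnerProductSpace.toDual_apply_apply] at hderiv
  rw [map_neg, hφw, real_inner_comm]
  exact neg_nonpos.2 hderiv
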